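/- All graphs are finite and simple; $d_G(v)$ denotes the degree of $v$ in $G$. A matching of a graph $G$ is a set $M\subseteq E(G)$ of edges no two of which share an endpoint; $V(M)$ is the set of endpoints of the edges of $M$, and $\mathcal M(G)$ is the set of all matchings of $G$ (including $\emptyset$). The multivariate matching polynomial of $G$ in indeterminates $(x_v)_{v\in V(G)}$ is $$\mathfrak{M}(G,(x_v)_{v\in V(G)})=\sum_{M\in\mathcal M(G)}(-1)^{|M|}\prod_{v\in V(G)\setminus V(M)}x_v,$$ and the Laplacian matching polynomial of $G$ is $$\mathscr{LM}(G,x)=\sum_{M\in\mathcal M(G)}(-1)^{|M|}\prod_{v\in V(G)\setminus V(M)}\bigl(x-d_G(v)\bigr).$$ For a subgraph $H$ of $G$ (not necessarily induced), let $\mathfrak{M}(H,x\mathbf 1_H-\mathbf d_{G,H})$ be the polynomial in $x$ obtained from $\mathfrak{M}(H,(x_v)_{v\in V(H)})$ by substituting $x_v=x-d_G(v)$ for every $v\in V(H)$. For $u\in V(H)$, the path-tree $T(H,u)$ is the graph whose vertices are the paths in $H$ starting at $u$ (including the one-vertex path), two of them being adjacent if one is a maximal proper subpath of the other. Let $A(T(H,u))$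 be its adjacency matrix and let $D_G(T(H,u))$ be the diagonal matrix, indexed by the vertices of $T(H,u)$, whose $(P,P)$-entry is $d_G(\upsilon(P))$, where $\upsilon(P)$ is the terminal vertex of $P$. For a real-rooted polynomial $f$, $\lambda(f)$ denotes its largest zero, and for a square matrix $B$ whose characteristic polynomial is real-rooted, $\lambda(B)$ denotes the largest zero of that polynomial. Theorem. Let $G$ be a connected graph, $H$ a connected subgraph of $G$, and $u\in V(H)$. Then the polynomials below are real-rooted, and $$\lambda\bigl(\mathfrak{M}(H,x\mathbf 1_H-\mathbf d_{G,H})\bigr)=\lambda\bigl(D_G(T(H,u))+A(T(H,u))\bigr).$$ In particular, $\lambda(\mathscr{LM}(G,x))=\lambda\bigl(D_G(T(G,u))+A(T(G,u))\bigr)$ for every $u\in V(G)$. Moreover, the largest zero of $\mathscr{LM}(G,x)$ is a simple root, that is, it has multiplicity $1$ as a root of $\mathscr{LM}(G,x)$. -/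

import Mathlib

open Polynomial

noncomputable section

open scoped Classical

/-- `M` is a matching of `G`: a set of edges of `G`, no two distinct ones of which share an
endpoint. -/
def IsGraphMatching {V : Type*} (G : SimpleGraph V) (M : Finset (Sym2 V)) : Prop :=
  (∀ e ∈ M, e ∈ G.edgeSet) ∧ ∀ e ∈ M, ∀ f ∈ M, e ≠ f → ∀ v, v ∈ e → v ∉ f

/-- The set of all matchings of the finite graph `G` (the empty matching included). -/
def graphMatchings {V : Type*} [Fintype V] (G : SimpleGraph V) : Finset (Finset (Sym2 V)) :=
  Finset.univ.filter fun M => IsGraphMatching G M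

/-- The set `V(G) \ V(M)` of the vertices that are not an endpoint of an edge in `M`. -/
def uncovered {V : Type*} [Fintype V] (M : Finset (Sym2 V)) : Finset V :=
  Finset.univ.filter fun v => ∀ e ∈ M, v ∉ e

/-- The multivariate matching polynomial of `G`, with one indeterminate for every vertex. -/
def multivariateMatchingPoly {V : Type*} [Fintype V] (G : SimpleGraph V) : MvPolynomial V ℝ :=
  ∑ M ∈ graphMatchings G, (-1) ^ M.card * ∏ v ∈ uncovered M, MvPolynomial.X v

/-- The polynomial in one indeterminate `x` that the multivariate matching polynomial of `G`
becomes when `x - d v` is substituted for the indeterminate of each vertex `v`. -/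
def shiftedMatchingPoly {V : Type*} [Fintype V] (G : SimpleGraph V) (d : V → ℝ) : ℝ[X] :=
  MvPolynomial.aeval (fun v => X - C (d v)) (multivariateMatchingPoly G)

/-- The Laplacian matching polynomial of `G`. -/
def laplacianMatchingPoly {V : Type*} [Fintype V] (G : SimpleGraph V) : ℝ[X] :=
  ∑ M ∈ graphMatchings G, (-1) ^ M.card * ∏ v ∈ uncovered M, (X - C (G.degree v : ℝ))

/-- The paths of `G` that start at `u`; the component `P.1` is the terminal vertex of `P`.
The one-vertex path `u` is included. -/
abbrev PathFrom {V : Type*} (G : SimpleGraph V) (u : V) : Type _ := Σ v : V, G.Path u v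

/-- `P` is a maximal proper subpath of `Q`, for paths `P`, `Q` starting at `u`: the path `Q`
is `P` prolonged by one edge at its terminal vertex. -/
def PathFrom.IsMaximalProperSubpath {V : Type*} {G : SimpleGraph V} {u : V}
    (P Q : PathFrom G u) : Prop :=
  ∃ h : G.Adj P.1 Q.1, (Q.2 : G.Walk u Q.1) = (P.2 : G.Walk u P.1).concat h

/-- The path-tree `T(G, u)`: its vertices are the paths of `G` starting at `u`, and two of them
are adjacent if one is a maximal proper subpath of the other. -/
def pathTree {V : Type*} (G : SimpleGraph V) (u : V) : SimpleGraph (PathFrom G u) where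
  Adj P Q := P.IsMaximalProperSubpath Q ∨ Q.IsMaximalProperSubpath P
  symm := ⟨fun _ _ h => h.symm⟩
  loopless := ⟨fun P h => by
    rcases h with ⟨h, -⟩ | ⟨h, -⟩ <;> exact G.loopless.irrefl _ h⟩

/-- The matrix `D + A(T(G, u))`, where `D` is the diagonal matrix whose entry at a path `P` is
`d v` for the terminal vertex `v` of `P`. -/
def pathTreeMatrix {V : Type*} [Fintype V] (G : SimpleGraph V) (u : V) (d : V → ℝ) :
    Matrix (PathFrom G u) (PathFrom G u) ℝ :=
  Matrix.diagonal (fun P => d P.1) + (pathTree G u).adjMatrix ℝ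

/-- `f` is real-rooted and `l` is its largest zero. -/
def IsLargestZero (f : ℝ[X]) (l : ℝ) : Prop :=
  f.Splits ∧ IsGreatest {x : ℝ | f.IsRoot x} l

/-- The characteristic polynomial of `A` is real-rooted and `l` is the largest eigenvalue
of `A`. -/
def IsLargestEigenvalue {ι : Type*} [Fintype ι] (A : Matrix ι ι ℝ) (l : ℝ) : Prop :=
  IsLargestZero A.charpoly l

end

/-!
Everything holds for an arbitrary shift `d` of the vertex weights. For a set `S` of vertices let
`m(S)` be the matching polynomial of the induced subgraph `G[S]` at the weights `x - d v`. The only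
combinatorial input is the deletion recurrence (`matchingSum_insert`), for `u ∉ S`,

  `m(S ∪ {u}) = (x - d u) m(S) - ∑ m(S \ {w})`, the sum over the neighbours `w ∈ S` of `u`.

*Real-rootedness.* At a point of the upper half plane the recurrence shows by induction that every
ratio `m(S ∪ {u}) / m(S)` lies in the upper half plane, so no `m(S)` vanishes there
(`matchingSum_ne_zero_and_im_pos`).

*The largest zero.* Let `l` be the largest real number at which some `m(S)` is nonpositive. At `l`
all `m(S)` are nonnegative, and connectedness together with the recurrence forces `m(S)(l) > 0` for
every proper subset `S` (`matchingSum_pos_of_forall_nonneg`), so that it is `m(V)` that vanishes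
at `l`, and `l` is its largest zero (`exists_largest_zero`). Since the derivative of `m(V)` is the
sum of the `m(V \ {u})`, it is positive at `l`, so the zero is simple.

*The path-tree.* Assign to a path `P` from `u` the number `f(P) = m(V \ V(P))(l) > 0`. The children
of `P` in the path-tree prolong `P` by an unvisited neighbour `w` of its terminal vertex `v`, and
its parent frees `v`; thus the recurrence at `v` says exactly that `f` is an eigenvector of
`D + A(T(G, u))` with eigenvalue `l`, the missing parent of the one-vertex path being accounted for
by `m(V)(l) = 0`. A positive eigenvector of a symmetric matrix with nonnegative off-diagonal
entries belongs to its largest eigenvalue (`isLargestEigenvalue_of_pos_eigenvector`).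
-/

noncomputable section

open scoped Classical

/-! ### Edges and paths -/

theorem isGraphMatching_insert {V : Type*} {G : SimpleGraph V} {M : Finset (Sym2 V)} {u w : V}
    (hM : IsGraphMatching G M) (huw : G.Adj u w) (hu : ∀ e ∈ M, u ∉ e) (hw : ∀ e ∈ M, w ∉ e) :
    IsGraphMatching G (insert s(u, w) M) := by
  obtain ⟨h1, h2⟩ := hM
  refine ⟨?_, ?_⟩
  · intro e he
    rcases Finset.mem_insert.1 he with rfl | he
    · exact huw
    · exact h1 e he
  · intro e he f hf hne v hve hvf
    rcases Finset.mem_insert.1 he with rfl | he' <;> rcases Finset.mem_insert.1 hf with rfl | hf'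
    · exact hne rfl
    · rcases Sym2.mem_iff.1 hve with rfl | rfl
      · exact hu f hf' hvf
      · exact hw f hf' hvf
    · rcases Sym2.mem_iff.1 hvf with rfl | rfl
      · exact hu e he' hve
      · exact hw e he' hve
    · exact h2 e he' f hf' hne v hve hvf

theorem PathFrom.IsMaximalProperSubpath.length_eq {V : Type*} {G : SimpleGraph V} {u : V}
    {P Q : PathFrom G u} (h : P.IsMaximalProperSubpath Q) :
    (Q.2 : G.Walk u Q.1).length = (P.2 : G.Walk u P.1).length + 1 := by
  obtain ⟨h, e⟩ := h
  rw [e, SimpleGraph.Walk.length_concat]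

theorem PathFrom.ext_walk {V : Type*} {G : SimpleGraph V} {u : V} {P Q : PathFrom G u}
    (h : P.1 = Q.1) (hw : (P.2 : G.Walk u P.1).copy rfl h = Q.2) : P = Q := by
  obtain ⟨v, p⟩ := P
  obtain ⟨w, q⟩ := Q
  obtain rfl : v = w := h
  obtain rfl : p = q := Subtype.ext hw
  rfl

variable {V : Type*} [Fintype V] {R : Type*} [CommRing R]

/-! ### Matching sums of induced subgraphs -/

/-- The matchings of `G` all of whose edges lie inside the vertex set `S`, that is, the matchings
of the induced subgraph `G[S]`, viewed as sets of edges of `G`. -/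
def matchingsOn (G : SimpleGraph V) (S : Finset V) : Finset (Finset (Sym2 V)) :=
  (graphMatchings G).filter fun M => ∀ e ∈ M, ∀ v ∈ e, v ∈ S

/-- The multivariate matching polynomial of the induced subgraph `G[S]`, evaluated at the weights
`x` in an arbitrary commutative ring. -/
def matchingSum (G : SimpleGraph V) (x : V → R) (S : Finset V) : R :=
  ∑ M ∈ matchingsOn G S, (-1) ^ M.card * ∏ v ∈ S with ∀ e ∈ M, v ∉ e, x v

theorem mem_matchingsOn {G : SimpleGraph V} {S : Finset V} {M : Finset (Sym2 V)} :
    M ∈ matchingsOn G S ↔ IsGraphMatching G M ∧ ∀ e ∈ M, ∀ v ∈ e, v ∈ S := by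
  simp [matchingsOn, graphMatchings]

theorem matchingSum_univ (G : SimpleGraph V) (x : V → R) :
    matchingSum G x Finset.univ =
      ∑ M ∈ graphMatchings G, (-1) ^ M.card * ∏ v ∈ uncovered M, x v := by
  simp [matchingSum, matchingsOn, uncovered]

theorem map_matchingSum {R' : Type*} [CommRing R'] (f : R →+* R') (G : SimpleGraph V)
    (x : V → R) (S : Finset V) :
    f (matchingSum G x S) = matchingSum G (fun v => f (x v)) S := by
  simp [matchingSum, map_sum, map_prod]

theorem matchingSum_empty (G : SimpleGraph V) (x : V → R) : matchingSum G x ∅ = 1 := by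
  have : matchingsOn G ∅ = {∅} := by
    ext M
    rw [mem_matchingsOn, Finset.mem_singleton]
    constructor
    · rintro ⟨-, h⟩
      refine Finset.eq_empty_of_forall_notMem fun e he => ?_
      induction e with
      | _ a b => exact absurd (h _ he a (Sym2.mem_mk_left a b)) (Finset.notMem_empty a)
    · rintro rfl
      simp [IsGraphMatching]
  simp [matchingSum, this]

theorem filter_matchingsOn_insert {G : SimpleGraph V} {S : Finset V} {u : V} (hu : u ∉ S) :
    ((matchingsOn G (insert u S)).filter fun M => ∀ e ∈ M, u ∉ e) = matchingsOn G S := by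
  ext M
  simp only [Finset.mem_filter, mem_matchingsOn, Finset.mem_insert]
  constructor
  · rintro ⟨⟨h, h1⟩, h2⟩
    refine ⟨h, fun e he v hv => (h1 e he v hv).resolve_left ?_⟩
    rintro rfl
    exact h2 e he hv
  · rintro ⟨h, h1⟩
    exact ⟨⟨h, fun e he v hv => Or.inr (h1 e he v hv)⟩, fun e he hue => hu (h1 e he u hue)⟩

/-- The matchings of `G[S ∪ {u}]` covering `u` arise exactly once by adding an edge `uw` to a
matching of `G[S \ {w}]`. -/
theorem sum_matchingsOn_insert_covered {G : SimpleGraph V} {S : Finset V} {u : V} (hu : u ∉ S)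
    (F : Finset (Sym2 V) → R) :
    ∑ M ∈ matchingsOn G (insert u S) with ¬ ∀ e ∈ M, u ∉ e, F M =
      ∑ w ∈ S with G.Adj u w, ∑ M ∈ matchingsOn G (S.erase w), F (insert s(u, w) M) := by
  rw [Finset.sum_sigma']
  symm
  refine Finset.sum_nbij (fun p => insert s(u, p.1) p.2) ?_ ?_ ?_ fun _ _ => rfl
  · rintro ⟨w, M⟩ h
    simp only [Finset.mem_sigma, Finset.mem_filter, mem_matchingsOn, Finset.mem_erase] at h ⊢
    obtain ⟨⟨hw, huw⟩, hM, hS⟩ := h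
    refine ⟨⟨isGraphMatching_insert hM huw (fun e he hue => hu (hS e he u hue).2)
      (fun e he hwe => (hS e he w hwe).1 rfl), ?_⟩, ?_⟩
    · intro e he v hv
      rcases Finset.mem_insert.1 he with rfl | he
      · rcases Sym2.mem_iff.1 hv with rfl | rfl
        · exact Finset.mem_insert_self _ _
        · exact Finset.mem_insert_of_mem hw
      · exact Finset.mem_insert_of_mem (hS e he v hv).2
    · intro h
      exact h _ (Finset.mem_insert_self _ _) (Sym2.mem_mk_left u w)
  · rintro ⟨w, M⟩ h ⟨w', M'⟩ h' heq
    simp only [Finset.coe_sigma, Set.mem_sigma_iff, Finset.mem_coe, Finset.mem_filter,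
      mem_matchingsOn, Finset.mem_erase] at h h' heq
    -- no edge inside `S` contains `u`, so `uw` is the only edge at `u` on either side
    have hn : ∀ a, s(u, a) ∉ M := fun a ha => hu (h.2.2 _ ha u (Sym2.mem_mk_left _ _)).2
    have hn' : ∀ a, s(u, a) ∉ M' := fun a ha => hu (h'.2.2 _ ha u (Sym2.mem_mk_left _ _)).2
    have hww : w = w' := by
      have : s(u, w) ∈ insert s(u, w') M' := heq ▸ Finset.mem_insert_self _ _
      rcases Finset.mem_insert.1 this with h | h
      · exact Sym2.congr_right.1 h
      · exact absurd h (hn' w)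
    subst hww
    have : M = M' := by
      rw [← Finset.erase_insert (hn w), ← Finset.erase_insert (hn' w), heq]
    rw [this]
  · intro M h
    simp only [Finset.mem_coe, Finset.mem_filter, mem_matchingsOn] at h
    obtain ⟨⟨⟨h1, h2⟩, hS⟩, hc⟩ := h
    push Not at hc
    obtain ⟨e, he, hue⟩ := hc
    obtain ⟨w, rfl⟩ := Sym2.mem_iff_exists.1 hue
    have huw : G.Adj u w := h1 _ he
    have hwS : w ∈ S := (Finset.mem_insert.1 (hS _ he w (Sym2.mem_mk_right _ _))).resolve_left
      huw.ne'
    refine ⟨⟨w, M.erase s(u, w)⟩, ?_, Finset.insert_erase he⟩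
    simp only [Finset.coe_sigma, Set.mem_sigma_iff, Finset.mem_coe, Finset.mem_filter,
      mem_matchingsOn, Finset.mem_erase]
    refine ⟨⟨hwS, huw⟩, ⟨fun e he => h1 e (Finset.mem_of_mem_erase he), fun e he f hf =>
      h2 e (Finset.mem_of_mem_erase he) f (Finset.mem_of_mem_erase hf)⟩, ?_⟩
    rintro f ⟨hfne, hf⟩ v hv
    have hvne := h2 _ hf _ he hfne v hv
    rw [Sym2.mem_iff, not_or] at hvne
    exact ⟨hvne.2, (Finset.mem_insert.1 (hS f hf v hv)).resolve_left hvne.1⟩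

/-- Deletion recurrence: a matching of `G[S ∪ {u}]` either misses `u`, or contains exactly one
edge at `u`. -/
theorem matchingSum_insert (G : SimpleGraph V) (x : V → R) {S : Finset V} {u : V} (hu : u ∉ S) :
    matchingSum G x (insert u S) =
      x u * matchingSum G x S - ∑ w ∈ S with G.Adj u w, matchingSum G x (S.erase w) := by
  rw [matchingSum, ← Finset.sum_filter_add_sum_filter_not _ (fun M => ∀ e ∈ M, u ∉ e),
    filter_matchingsOn_insert hu, sum_matchingsOn_insert_covered hu, sub_eq_add_neg]
  congr 1
  · rw [matchingSum, Finset.mul_sum]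
    refine Finset.sum_congr rfl fun M hM => ?_
    have huM : ∀ e ∈ M, u ∉ e := fun e he hue => hu ((mem_matchingsOn.1 hM).2 e he u hue)
    rw [Finset.filter_insert, if_pos huM, Finset.prod_insert (by simp [hu])]
    ring
  · rw [← Finset.sum_neg_distrib]
    refine Finset.sum_congr rfl fun w hw => ?_
    rw [matchingSum, ← Finset.sum_neg_distrib]
    refine Finset.sum_congr rfl fun M hM => ?_
    have hS := (mem_matchingsOn.1 hM).2
    have hn : s(u, w) ∉ M := fun h =>
      hu (Finset.mem_of_mem_erase (hS _ h u (Sym2.mem_mk_left _ _)))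
    have hfil : ((insert u S).filter fun v => ∀ e ∈ insert s(u, w) M, v ∉ e) =
        (S.erase w).filter fun v => ∀ e ∈ M, v ∉ e := by
      ext v
      simp only [Finset.mem_filter, Finset.mem_insert, forall_eq_or_imp, Sym2.mem_iff,
        Finset.mem_erase, not_or]
      constructor
      · rintro ⟨hv, ⟨h1, h2⟩, h3⟩
        exact ⟨⟨h2, hv.resolve_left h1⟩, h3⟩
      · rintro ⟨⟨h1, h2⟩, h3⟩
        exact ⟨Or.inr h2, ⟨fun h => hu (h ▸ h2), h1⟩, h3⟩
    rw [hfil, Finset.card_insert_of_notMem hn]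
    ring

/-- The derivative of the matching polynomial is the sum of the matching polynomials of the
vertex-deleted subgraphs. -/
theorem derivative_matchingSum (G : SimpleGraph V) (d : V → R) (S : Finset V) :
    derivative (matchingSum G (fun v => X - C (d v)) S) =
      ∑ u ∈ S, matchingSum G (fun v => X - C (d v)) (S.erase u) := by
  have hsgn : ∀ n : ℕ, ((-1 : R[X]) ^ n) = C ((-1) ^ n) := fun n => by simp
  have key : ∀ M : Finset (Sym2 V),
      derivative ((-1 : R[X]) ^ M.card * ∏ v ∈ S with ∀ e ∈ M, v ∉ e, (X - C (d v))) =
      ∑ u ∈ S, if ∀ e ∈ M, u ∉ e then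
        (-1 : R[X]) ^ M.card * ∏ v ∈ S.erase u with ∀ e ∈ M, v ∉ e, (X - C (d v)) else 0 := by
    intro M
    rw [hsgn, derivative_C_mul, derivative_prod_finset, ← Finset.sum_filter, Finset.mul_sum]
    refine Finset.sum_congr rfl fun u _ => ?_
    rw [Finset.filter_erase]
    simp
  rw [matchingSum, derivative_sum, Finset.sum_congr rfl fun M _ => key M, Finset.sum_comm]
  refine Finset.sum_congr rfl fun u hu => ?_
  rw [← Finset.sum_filter, matchingSum]
  refine Finset.sum_congr ?_ fun _ _ => rfl
  conv_lhs => rw [← Finset.insert_erase hu]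
  exact filter_matchingsOn_insert (Finset.notMem_erase u S)

/-! ### Real-rootedness -/

/-- For weights in the upper half plane the ratio of consecutive matching sums is again in the
upper half plane: by the deletion recurrence it is `x u` minus a sum of inverses of such ratios. -/
theorem matchingSum_ne_zero_and_im_pos (G : SimpleGraph V) {x : V → ℂ} (hx : ∀ v, 0 < (x v).im)
    (S : Finset V) :
    matchingSum G x S ≠ 0 ∧
      ∀ u ∉ S, 0 < (matchingSum G x (insert u S) / matchingSum G x S).im := by
  induction S using Finset.strongInduction with
  | H S ih =>
    have hne : matchingSum G x S ≠ 0 := by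
      rcases S.eq_empty_or_nonempty with rfl | ⟨w, hw⟩
      · simp [matchingSum_empty]
      · intro h0
        have := (ih _ (Finset.erase_ssubset hw)).2 w (Finset.notMem_erase w S)
        rw [Finset.insert_erase hw, h0] at this
        simp at this
    refine ⟨hne, fun u hu => ?_⟩
    rw [matchingSum_insert G x hu, sub_div, mul_div_assoc, div_self hne, mul_one, Finset.sum_div,
      Complex.sub_im, Complex.im_sum]
    have : ∑ w ∈ S with G.Adj u w, (matchingSum G x (S.erase w) / matchingSum G x S).im ≤ 0 := by
      refine Finset.sum_nonpos fun w hw => ?_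
      have hw := (Finset.mem_filter.1 hw).1
      have := (ih _ (Finset.erase_ssubset hw)).2 w (Finset.notMem_erase w S)
      rw [Finset.insert_erase hw] at this
      rw [← inv_div, Complex.inv_im]
      exact div_nonpos_of_nonpos_of_nonneg (by linarith) (Complex.normSq_nonneg _)
    linarith [hx u]

/-- A real polynomial without zeros in the open upper half plane is real-rooted. -/
theorem splits_of_forall_im_pos {p : ℝ[X]} (h : ∀ z : ℂ, 0 < z.im → aeval z p ≠ 0) :
    p.Splits := by
  refine Splits.of_splits_map (algebraMap ℝ ℂ) (IsAlgClosed.splits _) fun z hz => ?_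
  have hz0 : aeval z p = 0 := by
    have := (mem_roots'.1 hz).2
    rwa [IsRoot, eval_map_algebraMap] at this
  rcases lt_trichotomy z.im 0 with him | him | him
  · refine absurd ?_ (h (starRingEnd ℂ z) (by simpa using him))
    rw [aeval_conj, hz0, map_zero]
  · exact ⟨z.re, by apply Complex.ext <;> simp [him]⟩
  · exact absurd hz0 (h z him)

theorem splits_matchingSum (G : SimpleGraph V) (d : V → ℝ) (S : Finset V) :
    (matchingSum G (fun v => X - C (d v)) S).Splits := by
  refine splits_of_forall_im_pos fun z hz => ?_
  rw [← AlgHom.coe_toRingHom, map_matchingSum]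
  exact (matchingSum_ne_zero_and_im_pos G (fun v => by simpa using hz) S).1

/-! ### The largest zero -/

theorem eval_matchingSum (G : SimpleGraph V) (d : V → ℝ) (S : Finset V) (y : ℝ) :
    eval y (matchingSum G (fun v => X - C (d v)) S) = matchingSum G (fun v => y - d v) S := by
  rw [← coe_evalRingHom, map_matchingSum]
  simp

/-- For large weights all matching sums are positive, and they increase with the vertex set. -/
theorem matchingSum_pos_of_large (G : SimpleGraph V) {x : V → ℝ}
    (hx : ∀ v, (Fintype.card V : ℝ) + 1 ≤ x v) (S : Finset V) :
    0 < matchingSum G x S ∧ ∀ u ∉ S, matchingSum G x S ≤ matchingSum G x (insert u S) := by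
  induction S using Finset.strongInduction with
  | H S ih =>
    have hpos : 0 < matchingSum G x S := by
      rcases S.eq_empty_or_nonempty with rfl | ⟨w, hw⟩
      · simp [matchingSum_empty]
      · have h := ih _ (Finset.erase_ssubset hw)
        have := h.2 w (Finset.notMem_erase w S)
        rw [Finset.insert_erase hw] at this
        exact h.1.trans_le this
    refine ⟨hpos, fun u hu => ?_⟩
    rw [matchingSum_insert G x hu]
    have : ∑ w ∈ S with G.Adj u w, matchingSum G x (S.erase w) ≤
        Fintype.card V * matchingSum G x S := by
      calc _ ≤ ∑ w ∈ S with G.Adj u w, matchingSum G x S := by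
            refine Finset.sum_le_sum fun w hw => ?_
            have hw := (Finset.mem_filter.1 hw).1
            have := (ih _ (Finset.erase_ssubset hw)).2 w (Finset.notMem_erase w S)
            rwa [Finset.insert_erase hw] at this
        _ ≤ Fintype.card V * matchingSum G x S := by
            rw [Finset.sum_const, nsmul_eq_mul]
            gcongr
            exact Finset.card_le_univ _
    nlinarith [mul_le_mul_of_nonneg_right (hx u) hpos.le]

theorem continuous_matchingSum (G : SimpleGraph V) (d : V → ℝ) (S : Finset V) :
    Continuous fun y : ℝ => matchingSum G (fun v => y - d v) S := by
  simp_rw [← eval_matchingSum]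
  exact Polynomial.continuous _

theorem exists_adj_notMem_mem {G : SimpleGraph V} (hG : G.Connected) {T : Finset V}
    (hne : T.Nonempty) (hT : T ≠ Finset.univ) : ∃ v ∉ T, ∃ w ∈ T, G.Adj v w := by
  obtain ⟨a, ha⟩ := hne
  obtain ⟨b, hb⟩ : ∃ b, b ∉ T := by
    by_contra! h
    exact hT (Finset.eq_univ_iff_forall.2 h)
  obtain ⟨p⟩ := hG.preconnected a b
  obtain ⟨e, -, h1, h2⟩ := p.exists_boundary_dart (T : Set V) ha hb
  exact ⟨e.snd, h2, e.fst, h1, e.adj.symm⟩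

/-- If all matching sums of a connected graph are nonnegative, then those of proper induced
subgraphs are positive. Indeed, if the sum of `T` vanishes and `v ∉ T` is adjacent to `w ∈ T`, then
the deletion recurrence at `v` writes a nonnegative number as minus a sum of nonnegative numbers,
so the sum of `T \ {w}` vanishes too; descending to the empty set gives the contradiction
`1 = 0`. -/
theorem matchingSum_pos_of_forall_nonneg {G : SimpleGraph V} (hG : G.Connected) {x : V → ℝ}
    (h : ∀ S, 0 ≤ matchingSum G x S) (T : Finset V) (hT : T ≠ Finset.univ) :
    0 < matchingSum G x T := by
  induction T using Finset.strongInduction with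
  | H T ih =>
    rcases T.eq_empty_or_nonempty with rfl | hne
    · simp [matchingSum_empty]
    refine (h T).lt_of_ne' fun h0 => ?_
    obtain ⟨v, hv, w, hw, hvw⟩ := exists_adj_notMem_mem hG hne hT
    have hlt : 0 < matchingSum G x (T.erase w) :=
      ih _ (Finset.erase_ssubset hw) fun hu => Finset.notMem_erase w T (hu ▸ Finset.mem_univ w)
    have hle : matchingSum G x (T.erase w) ≤
        ∑ w ∈ T with G.Adj v w, matchingSum G x (T.erase w) :=
      Finset.single_le_sum (f := fun w => matchingSum G x (T.erase w)) (fun w _ => h _)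
        (Finset.mem_filter.2 ⟨hw, hvw⟩)
    have := h (insert v T)
    rw [matchingSum_insert G x hv, h0, mul_zero] at this
    linarith

/-- For a connected graph there is a point `l` beyond which all matching sums of induced subgraphs
are positive, while at `l` exactly the one of the whole graph vanishes. -/
theorem exists_largest_zero {G : SimpleGraph V} (hG : G.Connected) (d : V → ℝ) :
    ∃ l : ℝ, matchingSum G (fun v => l - d v) Finset.univ = 0 ∧
      (∀ T ≠ Finset.univ, 0 < matchingSum G (fun v => l - d v) T) ∧
      ∀ y > l, ∀ T, 0 < matchingSum G (fun v => y - d v) T := by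
  have hV := hG.nonempty
  let N : Set ℝ := ⋃ T : Finset V, {y | matchingSum G (fun v => y - d v) T ≤ 0}
  have hclosed : IsClosed N := isClosed_iUnion_of_finite fun T =>
    isClosed_le (continuous_matchingSum G d T) continuous_const
  have hnonempty : N.Nonempty := by
    obtain ⟨v⟩ := hV
    refine ⟨d v, Set.mem_iUnion.2 ⟨insert v ∅, ?_⟩⟩
    rw [Set.mem_ofPred_eq, matchingSum_insert G _ (Finset.notMem_empty v)]
    simp
  have hbdd : BddAbove N := by
    obtain ⟨c, hc⟩ := (Set.finite_range d).bddAbove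
    refine ⟨c + (Fintype.card V + 1), fun y hy => ?_⟩
    obtain ⟨T, hT⟩ := Set.mem_iUnion.1 hy
    by_contra! hlt
    refine (matchingSum_pos_of_large G (fun v => ?_) T).1.not_ge hT
    have := hc (Set.mem_range_self v)
    linarith
  have hl := hclosed.csSup_mem hnonempty hbdd
  set l := sSup N
  have hgt : ∀ y > l, ∀ T, 0 < matchingSum G (fun v => y - d v) T := by
    intro y hy T
    by_contra! hle
    exact (le_csSup hbdd (Set.mem_iUnion.2 ⟨T, hle⟩)).not_gt hy
  have hnonneg : ∀ T, 0 ≤ matchingSum G (fun v => l - d v) T := fun T =>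
    ge_of_tendsto (((continuous_matchingSum G d T).tendsto l).mono_left nhdsWithin_le_nhds)
      (Filter.eventually_of_mem self_mem_nhdsWithin fun y (hy : y ∈ Set.Ioi l) => (hgt y hy T).le)
  have hpos := matchingSum_pos_of_forall_nonneg hG hnonneg
  obtain ⟨T, hT⟩ := Set.mem_iUnion.1 hl
  have hTuniv : T = Finset.univ := by
    by_contra hne
    exact (hpos T hne).not_ge hT
  subst hTuniv
  exact ⟨l, le_antisymm hT (hnonneg _), hpos, hgt⟩

theorem rootMultiplicity_matchingSum_eq_one {G : SimpleGraph V} (hG : G.Connected) {d : V → ℝ}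
    {l : ℝ} (h0 : matchingSum G (fun v => l - d v) Finset.univ = 0)
    (hpos : ∀ T ≠ Finset.univ, 0 < matchingSum G (fun v => l - d v) T) :
    (matchingSum G (fun v => X - C (d v)) Finset.univ).rootMultiplicity l = 1 := by
  have hV := hG.nonempty
  have hder : 0 < eval l (derivative (matchingSum G (fun v => X - C (d v)) Finset.univ)) := by
    rw [derivative_matchingSum, eval_finsetSum]
    refine Finset.sum_pos (fun u _ => ?_) Finset.univ_nonempty
    rw [eval_matchingSum]
    exact hpos _ (Finset.erase_ssubset (Finset.mem_univ u)).ne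
  have hne : matchingSum G (fun v => X - C (d v)) Finset.univ ≠ 0 := by
    intro h
    simp [h] at hder
  refine le_antisymm (not_lt.1 fun h => ?_) ((rootMultiplicity_pos hne).2 ?_)
  · exact hder.ne' ((one_lt_rootMultiplicity_iff_isRoot hne).1 h).2
  · rw [IsRoot, eval_matchingSum, h0]

/-! ### Positive eigenvectors -/

/-- A positive eigenvector of a symmetric matrix with nonnegative off-diagonal entries belongs to
the largest eigenvalue. -/
theorem isLargestEigenvalue_of_pos_eigenvector {ι : Type*} [Fintype ι] [Nonempty ι]
    {A : Matrix ι ι ℝ} (hA : A.IsHermitian) (hoff : ∀ i j, i ≠ j → 0 ≤ A i j) {f : ι → ℝ} {l : ℝ}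
    (hf : ∀ i, 0 < f i) (hAf : ∀ i, A.mulVec f i = l * f i) : IsLargestEigenvalue A l := by
  have hroot : ∀ m : ℝ, A.charpoly.IsRoot m ↔ ∃ g ≠ 0, ∀ i, A.mulVec g i = m * g i := by
    intro m
    rw [IsRoot, Matrix.eval_charpoly, ← Matrix.exists_mulVec_eq_zero_iff]
    refine exists_congr fun g => and_congr_right fun _ => ?_
    rw [Matrix.sub_mulVec, Matrix.scalar_apply, sub_eq_zero, funext_iff]
    refine forall_congr' fun i => ?_
    rw [Matrix.mulVec_diagonal, eq_comm]
  refine ⟨hA.splits_charpoly, (hroot l).2 ⟨f, ?_, hAf⟩, ?_⟩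
  · rintro rfl
    exact lt_irrefl _ (hf (Classical.arbitrary ι))
  intro m hm
  obtain ⟨g, hg0, hg⟩ := (hroot m).1 hm
  obtain ⟨g, ⟨j, hj⟩, hg⟩ : ∃ g : ι → ℝ, (∃ j, 0 < g j) ∧ ∀ i, A.mulVec g i = m * g i := by
    obtain ⟨j, hj⟩ := Function.ne_iff.1 hg0
    rcases lt_or_gt_of_ne hj with hj | hj
    · exact ⟨-g, ⟨j, by simpa using hj⟩, fun i => by simp [Matrix.mulVec_neg, hg i]⟩
    · exact ⟨g, ⟨j, hj⟩, hg⟩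
  -- the multiple `c • f` dominates `g` and touches it at the coordinate `i`
  obtain ⟨i, hi⟩ := Finite.exists_max fun i => g i / f i
  set c := g i / f i
  have hc : 0 < c := (div_pos hj (hf j)).trans_le (hi j)
  have hle : ∀ k, g k ≤ c * f k := fun k => (div_le_iff₀ (hf k)).1 (hi k)
  have hgi : g i = c * f i := (div_mul_cancel₀ _ (hf i).ne').symm
  have hmul : m * g i ≤ c * (l * f i) := by
    rw [← hg i, ← hAf i, Matrix.mulVec, Matrix.mulVec, dotProduct, dotProduct, Finset.mul_sum]
    refine Finset.sum_le_sum fun k _ => ?_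
    by_cases hik : i = k
    · subst hik
      rw [hgi]
      exact le_of_eq (by ring)
    · calc A i k * g k ≤ A i k * (c * f k) := mul_le_mul_of_nonneg_left (hle k) (hoff i k hik)
        _ = c * (A i k * f k) := by ring
  rw [hgi] at hmul
  have : m * (c * f i) ≤ l * (c * f i) := by linarith
  exact le_of_mul_le_mul_right this (mul_pos hc (hf i))

/-! ### The path-tree -/

/-- The set of the vertices that the path `P` does not visit. -/
def PathFrom.unvisited {G : SimpleGraph V} {u : V} (P : PathFrom G u) : Finset V :=
  Finset.univ.filter fun v => v ∉ (P.2 : G.Walk u P.1).support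

theorem PathFrom.IsMaximalProperSubpath.endpoint_mem {G : SimpleGraph V} {u : V}
    {P Q : PathFrom G u} (h : P.IsMaximalProperSubpath Q) : Q.1 ∈ P.unvisited := by
  obtain ⟨h, e⟩ := h
  have hQ := Q.2.2
  rw [e, SimpleGraph.Walk.concat_isPath_iff] at hQ
  simpa [PathFrom.unvisited] using hQ.2

theorem PathFrom.IsMaximalProperSubpath.unvisited_eq {G : SimpleGraph V} {u : V}
    {P Q : PathFrom G u} (h : P.IsMaximalProperSubpath Q) :
    Q.unvisited = P.unvisited.erase Q.1 := by
  obtain ⟨h, e⟩ := h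
  ext v
  simp [PathFrom.unvisited, e, SimpleGraph.Walk.support_concat, and_comm]

/-- The children of `P` in the path-tree correspond to the unvisited neighbours of its terminal
vertex. -/
theorem PathFrom.sum_children {G : SimpleGraph V} {u : V} (P : PathFrom G u) (F : Finset V → ℝ) :
    ∑ Q : PathFrom G u with P.IsMaximalProperSubpath Q, F Q.unvisited =
      ∑ w ∈ P.unvisited with G.Adj P.1 w, F (P.unvisited.erase w) := by
  refine Finset.sum_nbij (fun Q => Q.1) ?_ ?_ ?_ ?_
  · intro Q hQ
    have hQ := (Finset.mem_filter.1 hQ).2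
    exact Finset.mem_filter.2 ⟨hQ.endpoint_mem, hQ.1⟩
  · intro Q hQ Q' hQ' heq
    obtain ⟨h, e⟩ := (Finset.mem_filter.1 hQ).2
    obtain ⟨h', e'⟩ := (Finset.mem_filter.1 hQ').2
    obtain ⟨v, q⟩ := Q
    obtain ⟨w, q'⟩ := Q'
    obtain rfl : v = w := heq
    obtain rfl : q = q' := Subtype.ext (e.trans e'.symm)
    rfl
  · intro w hw
    obtain ⟨hw, hadj⟩ := Finset.mem_filter.1 hw
    have hw : w ∉ (P.2 : G.Walk u P.1).support := by simpa [PathFrom.unvisited] using hw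
    exact ⟨⟨w, (P.2 : G.Walk u P.1).concat hadj, P.2.2.concat hw hadj⟩,
      Finset.mem_filter.2 ⟨Finset.mem_univ _, hadj, rfl⟩, rfl⟩
  · intro Q hQ
    rw [(Finset.mem_filter.1 hQ).2.unvisited_eq]

/-- A path has one parent in the path-tree, whose unvisited set has in addition the terminal vertex
of `P`; the one-vertex path has none. The hypothesis `F univ = 0` lets a single formula cover both
cases, since putting back the vertex of the one-vertex path gives the whole vertex set. -/
theorem PathFrom.sum_parents {G : SimpleGraph V} {u : V} (P : PathFrom G u) {F : Finset V → ℝ}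
    (hF : F Finset.univ = 0) :
    ∑ Q : PathFrom G u with Q.IsMaximalProperSubpath P, F Q.unvisited =
      F (insert P.1 P.unvisited) := by
  have hun : ∀ Q : PathFrom G u, Q.IsMaximalProperSubpath P →
      Q.unvisited = insert P.1 P.unvisited := fun Q hQ => by
    rw [hQ.unvisited_eq, Finset.insert_erase hQ.endpoint_mem]
  by_cases hP : ∃ Q : PathFrom G u, Q.IsMaximalProperSubpath P
  · obtain ⟨Q, hQ⟩ := hP
    have : (Finset.univ.filter fun Q : PathFrom G u => Q.IsMaximalProperSubpath P) = {Q} := by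
      refine Finset.eq_singleton_iff_unique_mem.2 ⟨by simpa using hQ, fun Q' hQ' => ?_⟩
      obtain ⟨h', e'⟩ := (Finset.mem_filter.1 hQ').2
      obtain ⟨h, e⟩ := hQ
      obtain ⟨hv, hw⟩ := SimpleGraph.Walk.concat_inj (e'.symm.trans e)
      exact PathFrom.ext_walk hv hw
    rw [this, Finset.sum_singleton, hun Q hQ]
  · have hnil : insert P.1 P.unvisited = Finset.univ := by
      obtain ⟨v, p, hp⟩ := P
      cases p with
      | nil =>
        ext v
        by_cases hv : v = u <;> simp [PathFrom.unvisited, hv]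
      | cons h p =>
        have hadj := (SimpleGraph.Walk.cons h p).adj_penultimate SimpleGraph.Walk.not_nil_cons
        have heq := SimpleGraph.Walk.concat_dropLast hadj
        have hpath := hp
        rw [← heq, SimpleGraph.Walk.concat_isPath_iff] at hpath
        exact absurd ⟨⟨_, _, hpath.1⟩, hadj, heq.symm⟩ hP
    rw [Finset.filter_eq_empty_iff.2 fun Q _ hQ => hP ⟨Q, hQ⟩, Finset.sum_empty, hnil, hF]

theorem PathFrom.sum_neighbors {G : SimpleGraph V} {u : V} (P : PathFrom G u)
    (f : PathFrom G u → ℝ) :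
    ((pathTree G u).adjMatrix ℝ).mulVec f P =
      (∑ Q : PathFrom G u with P.IsMaximalProperSubpath Q, f Q) +
        ∑ Q : PathFrom G u with Q.IsMaximalProperSubpath P, f Q := by
  rw [← Finset.sum_union, ← Finset.filter_or, Matrix.mulVec, dotProduct, Finset.sum_filter]
  · refine Finset.sum_congr rfl fun Q _ => ?_
    rw [SimpleGraph.adjMatrix_apply, ite_mul, one_mul, zero_mul]
    congr 1
  · refine Finset.disjoint_filter.2 fun Q _ h h' => ?_
    have := h.length_eq
    have := h'.length_eq
    omega

theorem isLargestEigenvalue_pathTreeMatrix {G : SimpleGraph V} {d : V → ℝ} {l : ℝ}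
    (h0 : matchingSum G (fun v => l - d v) Finset.univ = 0)
    (hpos : ∀ T ≠ Finset.univ, 0 < matchingSum G (fun v => l - d v) T) (u : V) :
    IsLargestEigenvalue (pathTreeMatrix G u d) l := by
  have : Nonempty (PathFrom G u) := ⟨⟨u, SimpleGraph.Path.nil⟩⟩
  have hend : ∀ P : PathFrom G u, P.1 ∉ P.unvisited := fun P => by
    simp [PathFrom.unvisited]
  refine isLargestEigenvalue_of_pos_eigenvector
    (f := fun P => matchingSum G (fun v => l - d v) P.unvisited) ?_ ?_ ?_ ?_
  · refine Matrix.IsHermitian.add (Matrix.isHermitian_diagonal _) ?_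
    rw [Matrix.IsHermitian, Matrix.conjTranspose_eq_transpose_of_trivial,
      SimpleGraph.transpose_adjMatrix]
  · intro P Q hPQ
    rw [pathTreeMatrix, Matrix.add_apply, Matrix.diagonal_apply_ne _ hPQ, zero_add,
      SimpleGraph.adjMatrix_apply]
    split_ifs <;> norm_num
  · exact fun P => hpos _ fun h => hend P (h ▸ Finset.mem_univ _)
  · intro P
    rw [pathTreeMatrix, Matrix.add_mulVec, Pi.add_apply, Matrix.mulVec_diagonal,
      PathFrom.sum_neighbors, P.sum_children, P.sum_parents h0, matchingSum_insert G _ (hend P)]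
    ring

/-! ### The largest zeros agree -/

theorem shiftedMatchingPoly_eq (G : SimpleGraph V) (d : V → ℝ) :
    shiftedMatchingPoly G d = matchingSum G (fun v => X - C (d v)) Finset.univ := by
  rw [matchingSum_univ, shiftedMatchingPoly, multivariateMatchingPoly]
  simp [map_sum, map_prod]

theorem laplacianMatchingPoly_eq (G : SimpleGraph V) :
    laplacianMatchingPoly G =
      matchingSum G (fun v => X - C (G.degree v : ℝ)) Finset.univ := by
  rw [matchingSum_univ, laplacianMatchingPoly]

/-- The common largest zero, for an arbitrary shift `d` of the vertex weights. -/
theorem exists_common_largest_zero {G : SimpleGraph V} (hG : G.Connected) (d : V → ℝ) :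
    ∃ l : ℝ, IsLargestZero (matchingSum G (fun v => X - C (d v)) Finset.univ) l ∧
      (∀ u, IsLargestEigenvalue (pathTreeMatrix G u d) l) ∧
      (matchingSum G (fun v => X - C (d v)) Finset.univ).rootMultiplicity l = 1 := by
  obtain ⟨l, h0, hpos, hgt⟩ := exists_largest_zero hG d
  refine ⟨l, ⟨splits_matchingSum G d _, ?_, fun y hy => ?_⟩,
    isLargestEigenvalue_pathTreeMatrix h0 hpos, rootMultiplicity_matchingSum_eq_one hG h0 hpos⟩
  · rw [Set.mem_ofPred_eq, IsRoot, eval_matchingSum, h0]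
  · rw [Set.mem_ofPred_eq, IsRoot, eval_matchingSum] at hy
    exact not_lt.1 fun hlt => (hgt y hlt Finset.univ).ne' hy

end

open scoped Classical in
theorem mainTheorem1 {V : Type*} [Fintype V] (G : SimpleGraph V) (hG : G.Connected) :
    (∀ H : G.Subgraph, H.Connected → ∀ u : H.verts,
      ∃ l : ℝ,
        IsLargestZero (shiftedMatchingPoly H.coe fun v => (G.degree (v : V) : ℝ)) l ∧
        IsLargestEigenvalue (pathTreeMatrix H.coe u fun v => (G.degree (v : V) : ℝ)) l) ∧
    (∃ l : ℝ,
      IsLargestZero (laplacianMatchingPoly G) l ∧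
      (∀ u : V, IsLargestEigenvalue (pathTreeMatrix G u fun v => (G.degree v : ℝ)) l) ∧
      (laplacianMatchingPoly G).rootMultiplicity l = 1) := by
  constructor
  · intro H hH u
    obtain ⟨l, h1, h2, -⟩ := exists_common_largest_zero hH.coe
      fun v : H.verts => (G.degree (v : V) : ℝ)
    have h2 := h2 u
    rw [← shiftedMatchingPoly_eq] at h1
    -- the two matrices may carry different decidability instances on `H.coe`
    exact ⟨l, h1, by convert h2⟩
  · obtain ⟨l, h1, h2, h3⟩ := exists_common_largest_zero hG fun v => (G.degree v : ℝ)
    rw [laplacianMatchingPoly_eq]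
    exact ⟨l, h1, h2, h3⟩
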